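/- Let $n\ge 0$, let $\mathbb R^n$ carry the Euclidean norm, and let $f:\mathbb R^n\to\mathbb R^n$ be a Lipschitz mapping. For $x\in\mathbb R^n$ let $$\partial f(x)=\operatorname{co}\Big\{\lim_{i\to\infty} df(x_i)\;:\; x_i\to x,\ f \text{ is differentiable at each } x_i,\ \text{and the limit exists}\Big\}$$ be the Clarke generalized differential of $f$ at $x$, where $\operatorname{co}$ denotes the convex hull and differentials are identified with real $n\times n$ matrices, and let $\operatorname{Spec}(\partial f(x))\subset\mathbb C$ be the set of all complex eigenvalues of all matrices $A\in\partial f(x)$. Suppose that for every $x\in\mathbb R^n$ every $A\in\partial f(x)$ has rank $n$. Let $x_0\in\mathbb R^n$ and, for $t>0$, put $$s(t)=\inf\big\{|\lambda|^n \;:\; x\in\overline B(x_0,t),\ \lambda\in\operatorname{Spec}(\partial f(x))\big\},$$ where $\overline B(x_0,t)$ is the closed ball (and $\inf\emptyset=\infty$, which is relevant only for $n=0$). If $$\int_0^\infty s(t)\,dt=\infty,$$ then $f$ is a homeomorphism of $\mathbb R^n$ onto $\mathbb R^n$. -/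

import Mathlib

open Filter Topology MeasureTheory
open scoped ENNReal

/-- The Clarke generalized differential of `f` at `x`: the convex hull of all limits of
differentials `df(x_i)`, taken along sequences `x_i → x` of points of differentiability of `f`. -/
def clarkeDifferential {E F : Type*} [NormedAddCommGroup E] [NormedSpace ℝ E]
    [NormedAddCommGroup F] [NormedSpace ℝ F] (f : E → F) (x : E) : Set (E →L[ℝ] F) :=
  convexHull ℝ {A | ∃ u : ℕ → E, Tendsto u atTop (𝓝 x) ∧ (∀ i, DifferentiableAt ℝ f (u i)) ∧
    Tendsto (fun i => fderiv ℝ f (u i)) atTop (𝓝 A)}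

/-- For `f : ℝⁿ → ℝⁿ`, the set `∂f(x)` has maximal rank if each of its elements has rank `n`. -/
def ClarkeMaximalRank {n : ℕ} (f : EuclideanSpace ℝ (Fin n) → EuclideanSpace ℝ (Fin n))
    (x : EuclideanSpace ℝ (Fin n)) : Prop :=
  ∀ A ∈ clarkeDifferential f x, Module.finrank ℝ (LinearMap.range A.toLinearMap) = n

/-- The real `n × n` matrix of a linear map `ℝⁿ → ℝⁿ` in the standard basis. -/
noncomputable def standardMatrix {n : ℕ}
    (A : EuclideanSpace ℝ (Fin n) →L[ℝ] EuclideanSpace ℝ (Fin n)) :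
    Matrix (Fin n) (Fin n) ℝ :=
  LinearMap.toMatrix (EuclideanSpace.basisFun (Fin n) ℝ).toBasis
    (EuclideanSpace.basisFun (Fin n) ℝ).toBasis A.toLinearMap

/-- `Spec(∂f(x))`: the complex eigenvalues of all matrices `A ∈ ∂f(x)`. -/
def clarkeSpec {n : ℕ} (f : EuclideanSpace ℝ (Fin n) → EuclideanSpace ℝ (Fin n))
    (x : EuclideanSpace ℝ (Fin n)) : Set ℂ :=
  {z | ∃ A ∈ clarkeDifferential f x,
    Module.End.HasEigenvalue (Matrix.toLin' ((standardMatrix A).map (algebraMap ℝ ℂ))) z}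

/-- `s(t) = inf {|z|ⁿ : x ∈ B̄(x₀, t), z ∈ Spec(∂f(x))}`, as an extended nonnegative number
(the infimum of the empty set, which occurs for `n = 0` or `t < 0`, is `∞`). -/
noncomputable def spectralInf {n : ℕ}
    (f : EuclideanSpace ℝ (Fin n) → EuclideanSpace ℝ (Fin n))
    (x₀ : EuclideanSpace ℝ (Fin n)) (t : ℝ) : ℝ≥0∞ :=
  ⨅ x ∈ Metric.closedBall x₀ t, ⨅ z ∈ clarkeSpec f x, ENNReal.ofReal (‖z‖ ^ n)

/-! ### Clarke's inverse function theorem. -/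

section ClarkeLocal

open Metric Set
open scoped RealInnerProductSpace NNReal

/-! The determinant of `A ∈ ∂f(x)` is the product of its `n` eigenvalues, so `|det A| ≥ s(|x -
x₀|)`. As `‖A‖ ≤ K` bounds the adjugate, `A` expands norms by at least `m(|x - x₀|)`, where `m = s /
C`. Since `s` decreases and has divergent integral, it is positive everywhere.

Convexity of `∂f(x)` transfers this to `f`: one direction separates all the vectors `A v` from `0`,
and a mean value inequality makes `f` expand near `x` by every factor below `m(|x - x₀|)`
(`exists_mul_norm_sub_le_of_clarkeDifferential`). Minimizing `‖f - b‖` gives openness, so `f` is a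
local homeomorphism.

Hadamard's argument makes this global. A lift of a segment cannot escape to infinity, because the
integral of `m` up to its distance from `x₀` is at most the length covered
(`integral_norm_sub_le_of_lift`). So all segments from `f x₀` lift, and the endpoints of the lifts
define a continuous inverse. -/

theorem LipschitzWith.norm_le_of_mem_clarkeDifferential {E F : Type*} [NormedAddCommGroup E]
    [NormedSpace ℝ E] [NormedAddCommGroup F] [NormedSpace ℝ F] {f : E → F} {K : ℝ≥0}
    (hf : LipschitzWith K f) {x : E} {A : E →L[ℝ] F} (hA : A ∈ clarkeDifferential f x) :
    ‖A‖ ≤ K := by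
  have h : clarkeDifferential f x ⊆ closedBall 0 K := by
    refine convexHull_min ?_ (convex_closedBall _ _)
    rintro B ⟨u, -, -, hB⟩
    rw [mem_closedBall_zero_iff]
    exact le_of_tendsto hB.norm (Eventually.of_forall fun i => norm_fderiv_le_of_lipschitz ℝ hf)
  simpa using h hA

theorem LipschitzWith.exists_tendsto_fderiv_mem_clarkeDifferential {E F : Type*}
    [NormedAddCommGroup E] [NormedSpace ℝ E] [FiniteDimensional ℝ E] [NormedAddCommGroup F]
    [NormedSpace ℝ F] [FiniteDimensional ℝ F] {f : E → F} {K : ℝ≥0} (hf : LipschitzWith K f)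
    {x : E} {u : ℕ → E} (hu : Tendsto u atTop (𝓝 x)) (hd : ∀ i, DifferentiableAt ℝ f (u i)) :
    ∃ A ∈ clarkeDifferential f x, ∃ φ : ℕ → ℕ, StrictMono φ ∧
      Tendsto (fun i => fderiv ℝ f (u (φ i))) atTop (𝓝 A) := by
  have : ProperSpace (E →L[ℝ] F) := FiniteDimensional.proper ℝ _
  obtain ⟨A, -, φ, hφ, hA⟩ := (isCompact_closedBall (0 : E →L[ℝ] F) K).tendsto_subseq
    (x := fun i => fderiv ℝ f (u i))
    (fun i => by simpa using norm_fderiv_le_of_lipschitz ℝ hf)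
  exact ⟨A, subset_convexHull ℝ _ ⟨u ∘ φ, hu.comp hφ.tendsto_atTop, fun i => hd _, hA⟩, φ, hφ, hA⟩

/-- Rademacher's theorem makes the Clarke differential of a Lipschitz map nonempty. -/
theorem LipschitzWith.nonempty_clarkeDifferential {E F : Type*}
    [NormedAddCommGroup E] [NormedSpace ℝ E] [FiniteDimensional ℝ E] [NormedAddCommGroup F]
    [NormedSpace ℝ F] [FiniteDimensional ℝ F] {f : E → F} {K : ℝ≥0} (hf : LipschitzWith K f)
    (x : E) : (clarkeDifferential f x).Nonempty := by
  borelize E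
  have hdense : Dense {y | DifferentiableAt ℝ f y} :=
    Measure.dense_of_ae (hf.ae_differentiableAt (μ := Measure.addHaar))
  obtain ⟨u, hu, hux⟩ := mem_closure_iff_seq_limit.1 (hdense x)
  obtain ⟨A, hA, -⟩ := hf.exists_tendsto_fderiv_mem_clarkeDifferential hux hu
  exact ⟨A, hA⟩

/-- The Clarke differential is upper semicontinuous. -/
theorem LipschitzWith.exists_mem_clarkeDifferential_norm_sub_lt {E F : Type*}
    [NormedAddCommGroup E] [NormedSpace ℝ E] [FiniteDimensional ℝ E] [NormedAddCommGroup F]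
    [NormedSpace ℝ F] [FiniteDimensional ℝ F] {f : E → F} {K : ℝ≥0} (hf : LipschitzWith K f)
    (x : E) {ε : ℝ} (hε : 0 < ε) :
    ∃ r > 0, ∀ y ∈ ball x r, DifferentiableAt ℝ f y →
      ∃ A ∈ clarkeDifferential f x, ‖fderiv ℝ f y - A‖ < ε := by
  by_contra! h
  choose u hux hud hu using fun i : ℕ => h (1 / ((i : ℝ) + 1)) Nat.one_div_pos_of_nat
  have hlim : Tendsto u atTop (𝓝 x) := by
    rw [tendsto_iff_dist_tendsto_zero]
    exact squeeze_zero (fun _ => dist_nonneg) (fun i => (mem_ball.1 (hux i)).le)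
      tendsto_one_div_add_atTop_nhds_zero_nat
  obtain ⟨A, hA, φ, -, hφ⟩ := hf.exists_tendsto_fderiv_mem_clarkeDifferential hlim hud
  obtain ⟨i, hi⟩ := ((tendsto_iff_norm_sub_tendsto_zero.1 hφ).eventually (gt_mem_nhds hε)).exists
  exact (hu (φ i) A hA).not_gt hi

theorem LipschitzWith.mul_sub_le_sub_of_ae_le_deriv {h : ℝ → ℝ} {K : ℝ≥0}
    (hh : LipschitzWith K h) {a b c : ℝ} (hab : a ≤ b)
    (hc : ∀ᵐ s, s ∈ Icc a b → c ≤ deriv h s) : c * (b - a) ≤ h b - h a := by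
  have hac : AbsolutelyContinuousOnInterval h a b :=
    (hh.lipschitzOnWith (s := uIcc a b)).absolutelyContinuousOnInterval
  rw [← hac.integral_deriv_eq_sub]
  have := intervalIntegral.integral_mono_ae_restrict hab
    (intervalIntegrable_const (μ := volume) (c := c)) hac.intervalIntegrable_deriv
    ((ae_restrict_iff' measurableSet_Icc).2 hc)
  simpa [mul_comm] using this

/-- A mean value inequality for Lipschitz maps from bounds at points of differentiability. -/
theorem LipschitzWith.le_inner_sub_of_forall_le_inner_fderiv {E F : Type*}
    [NormedAddCommGroup E] [NormedSpace ℝ E] [FiniteDimensional ℝ E] [NormedAddCommGroup F]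
    [InnerProductSpace ℝ F] [FiniteDimensional ℝ F] {f : E → F} {K : ℝ≥0}
    (hf : LipschitzWith K f) {U : Set E} (hU : IsOpen U) (hconv : Convex ℝ U) {y z : E}
    (hy : y ∈ U) (hz : z ∈ U) {w : F} {c : ℝ}
    (h : ∀ x ∈ U, DifferentiableAt ℝ f x → c ≤ ⟪w, fderiv ℝ f x (z - y)⟫) :
    c ≤ ⟪w, f z - f y⟫ := by
  borelize E
  by_contra! hlt
  set v := z - y with hv
  have hfc := hf.continuous
  have hopen : ∀ᶠ x in 𝓝 y, x ∈ U ∧ x + v ∈ U ∧ ⟪w, f (x + v) - f x⟫ < c := by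
    have hyv : y + v = z := by simp [hv]
    refine .and (hU.mem_nhds hy) (.and ?_ ?_)
    · exact (by fun_prop : Continuous fun x : E => x + v).continuousAt.eventually
        (hU.mem_nhds (by simpa only [hyv] using hz))
    · exact ((by fun_prop : Continuous fun x : E => ⟪w, f (x + v) - f x⟫).continuousAt).eventually
        (gt_mem_nhds (by simpa only [hyv] using hlt))
  -- Rademacher and Fubini: for almost every base point, `f` is differentiable almost everywhere on
  -- the line in direction `v`. The given segment may be exceptional, but failure of the inequality
  -- persists under small translations.
  have hae : ∀ᵐ x ∂(Measure.addHaar : Measure E), ∀ᵐ s : ℝ,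
      x + LinearMap.toSpanSingleton ℝ E v s ∈ {x | DifferentiableAt ℝ f x} :=
    (ae_ae_add_linearMap_mem_iff _ volume _ (measurableSet_of_differentiableAt ℝ f)).2
      hf.ae_differentiableAt
  obtain ⟨x, hx, hxU, hxvU, hxlt⟩ := (Measure.dense_of_ae hae).inter_nhds_nonempty hopen
  set g : ℝ → ℝ := fun s => ⟪w, f (x + s • v)⟫ with hg
  have hgL : LipschitzWith (‖w‖₊ * (K * ‖v‖₊)) g := by
    refine LipschitzWith.of_dist_le_mul fun s t => ?_
    rw [Real.dist_eq, hg]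
    simp only
    rw [← inner_sub_right]
    refine (abs_real_inner_le_norm _ _).trans ?_
    have := hf.dist_le_mul (x + s • v) (x + t • v)
    rw [dist_add_left, dist_eq_norm, dist_eq_norm, ← sub_smul, norm_smul] at this
    push_cast
    rw [mul_assoc, mul_assoc, mul_comm ‖v‖]
    gcongr
    exact this
  have hderiv : ∀ᵐ s : ℝ, s ∈ Icc (0 : ℝ) 1 → c ≤ deriv g s := by
    filter_upwards [hx] with s hs hs01
    have hs' : DifferentiableAt ℝ f (x + s • v) := by simpa using hs
    have hline : HasDerivAt (fun s : ℝ => x + s • v) v s := by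
      simpa using ((hasDerivAt_id s).smul_const v).const_add x
    have h1 : HasDerivAt g ⟪w, fderiv ℝ f (x + s • v) v⟫ s := by
      have := (hs'.hasFDerivAt.comp_hasDerivAt s hline)
      simpa using (hasDerivAt_const s w).inner ℝ this
    rw [h1.deriv]
    refine h _ ?_ hs'
    have := hconv.add_smul_sub_mem hxU hxvU hs01
    simpa using this
  have := hgL.mul_sub_le_sub_of_ae_le_deriv zero_le_one hderiv
  simp only [hg, sub_zero, mul_one, one_smul, zero_smul, add_zero, ← inner_sub_right] at this
  exact this.not_gt hxlt

/-- The point `p` of the closure nearest to `0` satisfies `⟪p, q⟫ ≥ ‖p‖²` on `D`, so `p / ‖p‖`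
works. Allowing `w = 0` covers the cases `D = ∅` and `p = 0`. -/
theorem Convex.exists_norm_le_one_forall_le_inner {F : Type*} [NormedAddCommGroup F]
    [InnerProductSpace ℝ F] [CompleteSpace F] {D : Set F} (hD : Convex ℝ D) {δ : ℝ}
    (h : ∀ q ∈ D, δ ≤ ‖q‖) : ∃ w : F, ‖w‖ ≤ 1 ∧ ∀ q ∈ D, δ ≤ ⟪w, q⟫ := by
  rcases D.eq_empty_or_nonempty with rfl | hne
  · exact ⟨0, by simp, by simp⟩
  obtain ⟨p, hp, hmin⟩ := exists_norm_eq_iInf_of_complete_convex hne.closure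
    isClosed_closure.isComplete hD.closure 0
  have hvar := (norm_eq_iInf_iff_real_inner_le_zero hD.closure hp).1 hmin
  have hpδ : δ ≤ ‖p‖ := closure_minimal (t := {q | δ ≤ ‖q‖}) h
    (isClosed_le continuous_const continuous_norm) hp
  rcases eq_or_ne p 0 with rfl | hp0
  · exact ⟨0, by simp, fun q _ => by simpa using hpδ⟩
  have hpos : 0 < ‖p‖ := norm_pos_iff.2 hp0
  refine ⟨‖p‖⁻¹ • p, by simp [norm_smul, hpos.ne'], fun q hq => hpδ.trans ?_⟩
  have := hvar q (subset_closure hq)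
  rw [zero_sub, inner_neg_left, inner_sub_right, real_inner_self_eq_norm_sq] at this
  rw [real_inner_smul_left, ← div_eq_inv_mul, le_div_iff₀ hpos]
  nlinarith

/-- If the elements of `∂f(x)` expand norms by at least `δ`, then near `x` the map `f` expands
distances by every factor less than `δ`. -/
theorem LipschitzWith.exists_mul_norm_sub_le_of_clarkeDifferential {E F : Type*}
    [NormedAddCommGroup E] [NormedSpace ℝ E] [FiniteDimensional ℝ E] [NormedAddCommGroup F]
    [InnerProductSpace ℝ F] [FiniteDimensional ℝ F] {f : E → F} {K : ℝ≥0}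
    (hf : LipschitzWith K f) {x : E} {δ δ' : ℝ}
    (h : ∀ A ∈ clarkeDifferential f x, ∀ v, δ * ‖v‖ ≤ ‖A v‖) (hδ : δ' < δ) :
    ∃ r > 0, ∀ y ∈ ball x r, ∀ z ∈ ball x r, δ' * ‖z - y‖ ≤ ‖f z - f y‖ := by
  obtain ⟨r, hr, husc⟩ := hf.exists_mem_clarkeDifferential_norm_sub_lt x (sub_pos.2 hδ)
  refine ⟨r, hr, fun y hy z hz => ?_⟩
  have hD : Convex ℝ ((fun A : E →L[ℝ] F => A (z - y)) '' clarkeDifferential f x) :=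
    (convex_convexHull ℝ _).is_linear_image
      (f := fun A : E →L[ℝ] F => A (z - y)) ⟨fun _ _ => rfl, fun _ _ => rfl⟩
  obtain ⟨w, hw, hsep⟩ := hD.exists_norm_le_one_forall_le_inner
    (δ := δ * ‖z - y‖) (by rintro _ ⟨A, hA, rfl⟩; exact h A hA _)
  have key : δ' * ‖z - y‖ ≤ ⟪w, f z - f y⟫ := by
    refine hf.le_inner_sub_of_forall_le_inner_fderiv isOpen_ball (convex_ball x r) hy hz
      fun p hp hd => ?_
    obtain ⟨A, hA, hAε⟩ := husc p hp hd
    have h1 := hsep _ (mem_image_of_mem _ hA)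
    have h2 : |⟪w, (fderiv ℝ f p - A) (z - y)⟫| ≤ (δ - δ') * ‖z - y‖ :=
      calc _ ≤ ‖w‖ * ‖(fderiv ℝ f p - A) (z - y)‖ := abs_real_inner_le_norm _ _
        _ ≤ 1 * (‖fderiv ℝ f p - A‖ * ‖z - y‖) := by
            gcongr; exact ContinuousLinearMap.le_opNorm _ _
        _ ≤ _ := by rw [one_mul]; gcongr
    rw [_root_.sub_apply, inner_sub_right] at h2
    have := (abs_le.1 h2).1
    linarith
  calc _ ≤ _ := key
    _ ≤ ‖w‖ * ‖f z - f y‖ := real_inner_le_norm _ _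
    _ ≤ 1 * ‖f z - f y‖ := by gcongr
    _ = _ := one_mul _

/-- A local minimum of the distance to `b` along `f` takes the value `b` if the elements of the
Clarke differential there are uniformly invertible. -/
theorem LipschitzWith.eq_of_isLocalMin_norm_sub {E : Type*} [NormedAddCommGroup E]
    [InnerProductSpace ℝ E] [FiniteDimensional ℝ E] {f : E → E} {K : ℝ≥0}
    (hf : LipschitzWith K f) {x b : E} {δ : ℝ} (hδ : 0 < δ)
    (h : ∀ A ∈ clarkeDifferential f x, ∀ v, δ * ‖v‖ ≤ ‖A v‖)
    (hmin : IsLocalMin (fun z => ‖f z - b‖) x) : f x = b := by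
  by_contra hne
  set w := f x - b with hw
  have hwpos : 0 < ‖w‖ := norm_pos_iff.2 (sub_ne_zero.2 hne)
  -- The adjoint inherits the bound: if `A v = w`, then `‖w‖² = ⟪A* w, v⟫ ≤ ‖A* w‖ ‖w‖ / δ`.
  have hadj : ∀ A ∈ clarkeDifferential f x, δ * ‖w‖ ≤ ‖ContinuousLinearMap.adjoint A w‖ := by
    intro A hA
    have hinj : Function.Injective A := by
      rw [injective_iff_map_eq_zero]
      intro v hv
      have := h A hA v
      rw [hv, norm_zero] at this
      by_contra hv0
      have := norm_pos_iff.2 hv0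
      nlinarith
    obtain ⟨v, hv⟩ := LinearMap.surjective_of_injective (f := A.toLinearMap) hinj w
    replace hv : A v = w := hv
    have h1 := h A hA v
    have h2 : ‖w‖ ^ 2 ≤ ‖ContinuousLinearMap.adjoint A w‖ * ‖v‖ := by
      rw [← real_inner_self_eq_norm_sq]
      nth_rewrite 2 [← hv]
      rw [← ContinuousLinearMap.adjoint_inner_left]
      exact real_inner_le_norm _ _
    rw [hv] at h1
    have h3 := norm_nonneg (ContinuousLinearMap.adjoint A w)
    refine le_of_mul_le_mul_right ?_ hwpos
    nlinarith
  have hD : Convex ℝ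
      ((fun A : E →L[ℝ] E => ContinuousLinearMap.adjoint A w) '' clarkeDifferential f x) :=
    (convex_convexHull ℝ _).is_linear_image
      (f := fun A : E →L[ℝ] E => ContinuousLinearMap.adjoint A w)
      ⟨fun _ _ => by simp, fun c A => by simp⟩
  obtain ⟨v, hv, hsep⟩ := hD.exists_norm_le_one_forall_le_inner
    (δ := δ * ‖w‖) (by rintro _ ⟨A, hA, rfl⟩; exact hadj A hA)
  obtain ⟨r, hr, husc⟩ := hf.exists_mem_clarkeDifferential_norm_sub_lt x (half_pos hδ)
  -- Separating the vectors `A* w` from `0` makes `-v` a common descent direction for `‖f - b‖`.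
  have hdesc : ∀ t : ℝ, 0 ≤ t → x - t • v ∈ ball x r →
      t * (δ / 2 * ‖w‖) ≤ ⟪w, f x - f (x - t • v)⟫ := by
    intro t ht hmem
    refine hf.le_inner_sub_of_forall_le_inner_fderiv isOpen_ball (convex_ball x r) hmem
      (mem_ball_self hr) fun p hp hd => ?_
    obtain ⟨A, hA, hAε⟩ := husc p hp hd
    have h1 := hsep _ (mem_image_of_mem _ hA)
    rw [real_inner_comm, ContinuousLinearMap.adjoint_inner_left] at h1
    have h2 : |⟪w, (fderiv ℝ f p - A) v⟫| ≤ δ / 2 * ‖w‖ :=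
      calc _ ≤ ‖w‖ * ‖(fderiv ℝ f p - A) v‖ := abs_real_inner_le_norm _ _
        _ ≤ ‖w‖ * (‖fderiv ℝ f p - A‖ * ‖v‖) := by
            gcongr; exact ContinuousLinearMap.le_opNorm _ _
        _ ≤ ‖w‖ * (δ / 2 * 1) := by gcongr
        _ = _ := by ring
    rw [_root_.sub_apply, inner_sub_right] at h2
    have h3 := (abs_le.1 h2).1
    rw [sub_sub_cancel, map_smul, real_inner_smul_right]
    gcongr
    linarith
  have hcont : Tendsto (fun t : ℝ => x - t • v) (𝓝[>] 0) (𝓝 x) := by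
    have : Continuous fun t : ℝ => x - t • v := by fun_prop
    simpa using (this.tendsto 0).mono_left nhdsWithin_le_nhds
  -- For such `t` the linear gain `t δ ‖w‖` in `‖w - d‖²` beats the quadratic loss `(K t)²`.
  have hsmall : ∀ᶠ t : ℝ in 𝓝[>] 0, t * (K : ℝ) ^ 2 < δ * ‖w‖ := by
    have : Continuous fun t : ℝ => t * (K : ℝ) ^ 2 := by fun_prop
    refine (this.tendsto 0).mono_left nhdsWithin_le_nhds |>.eventually (gt_mem_nhds ?_)
    rw [zero_mul]
    positivity
  obtain ⟨t, htmin, htball, htsmall, ht⟩ := ((hcont.eventually hmin).and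
    ((hcont.eventually (ball_mem_nhds x hr)).and (hsmall.and self_mem_nhdsWithin))).exists
  replace ht : 0 < t := ht
  have h1 := hdesc t ht.le htball
  set d := f x - f (x - t • v) with hd
  have hdn : ‖d‖ ≤ K * t := by
    have := hf.dist_le_mul x (x - t • v)
    rw [dist_eq_norm, dist_eq_norm, sub_sub_cancel, norm_smul, Real.norm_of_nonneg ht.le] at this
    refine this.trans ?_
    gcongr
    exact mul_le_of_le_one_right ht.le hv
  have h2 : ‖w‖ ≤ ‖w - d‖ := by
    have : f (x - t • v) - b = w - d := by rw [hw, hd]; abel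
    rw [← this]
    exact htmin
  have h3 : ‖w‖ ^ 2 ≤ ‖w - d‖ ^ 2 := by gcongr
  rw [norm_sub_sq_real w d] at h3
  have h4 : ‖d‖ ^ 2 ≤ (K * t) ^ 2 := by gcongr
  have h5 : t * (t * (K : ℝ) ^ 2) < t * (δ * ‖w‖) := by gcongr
  nlinarith

/-- Clarke's inverse function theorem, in the form that a Lipschitz map whose Clarke differentials
are uniformly invertible at each point is a local homeomorphism. -/
theorem LipschitzWith.isLocalHomeomorph_of_clarkeDifferential {E : Type*} [NormedAddCommGroup E]
    [InnerProductSpace ℝ E] [FiniteDimensional ℝ E] {f : E → E} {K : ℝ≥0}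
    (hf : LipschitzWith K f)
    (h : ∀ x, ∃ δ > 0, ∀ A ∈ clarkeDifferential f x, ∀ v, δ * ‖v‖ ≤ ‖A v‖) :
    IsLocalHomeomorph f := by
  have hexp : ∀ x, ∃ δ > 0, ∃ r > 0, ∀ y ∈ ball x r, ∀ z ∈ ball x r,
      δ * ‖z - y‖ ≤ ‖f z - f y‖ := by
    intro x
    obtain ⟨δ, hδ, hx⟩ := h x
    exact ⟨δ / 2, half_pos hδ,
      hf.exists_mul_norm_sub_le_of_clarkeDifferential hx (half_lt_self hδ)⟩
  have hopen : IsOpenMap f := by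
    rw [isOpenMap_iff_nhds_le]
    intro x
    obtain ⟨δ, hδ, r, hr, hexp⟩ := hexp x
    rw [((nhds_basis_closedBall (x := x)).map f).ge_iff]
    intro ρ' hρ'
    obtain ⟨ρ, hρ, hρρ', hρr⟩ : ∃ ρ > 0, ρ ≤ ρ' ∧ ρ < r :=
      ⟨min ρ' (r / 2), by positivity, min_le_left _ _, (min_le_right _ _).trans_lt (by linarith)⟩
    -- On the sphere of radius `ρ` one has `‖f z - f x‖ ≥ δ ρ`, so for `b` within `δ ρ / 2` of `f x`
    -- the minimizer is interior.
    refine mem_of_superset (ball_mem_nhds (f x) (by positivity : 0 < δ * ρ / 2)) fun b hb => ?_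
    rw [mem_ball_iff_norm'] at hb
    obtain ⟨z, hz, hzmin⟩ := (isCompact_closedBall x ρ).exists_isMinOn
      ⟨x, mem_closedBall_self hρ.le⟩
      (by have := hf.continuous; fun_prop : ContinuousOn (fun z => ‖f z - b‖) (closedBall x ρ))
    have hzx : ‖f z - b‖ < δ * ρ / 2 :=
      (isMinOn_iff.1 hzmin x (mem_closedBall_self hρ.le)).trans_lt hb
    have hzball : z ∈ ball x ρ := by
      have h1 := hexp x (mem_ball_self hr) z (closedBall_subset_ball hρr hz)
      have h2 : ‖f z - f x‖ ≤ ‖f z - b‖ + ‖f x - b‖ := by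
        simpa [dist_eq_norm] using dist_triangle_right (f z) (f x) b
      rw [mem_ball_iff_norm]
      nlinarith
    obtain ⟨δz, hδz, hAz⟩ := h z
    exact ⟨z, closedBall_subset_closedBall hρρ' hz, hf.eq_of_isLocalMin_norm_sub hδz hAz
      (hzmin.isLocalMin (mem_of_superset (isOpen_ball.mem_nhds hzball) ball_subset_closedBall))⟩
  rw [isLocalHomeomorph_iff_isOpenEmbedding_restrict]
  intro x
  obtain ⟨δ, hδ, r, hr, hexp⟩ := hexp x
  refine ⟨ball x r, ball_mem_nhds x hr, .of_continuous_injective_isOpenMap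
    (hf.continuous.comp continuous_subtype_val) ?_ (hopen.comp isOpen_ball.isOpenMap_subtype_val)⟩
  rintro ⟨y, hy⟩ ⟨z, hz⟩ heq
  have := hexp y hy z hz
  replace heq : f y = f z := heq
  rw [heq, sub_self, norm_zero] at this
  have h0 : ‖z - y‖ = 0 := by
    have := norm_nonneg (z - y)
    nlinarith
  exact Subtype.ext (sub_eq_zero.1 (norm_eq_zero.1 h0)).symm

end ClarkeLocal

/-! ### Hadamard's theorem by lifting segments. -/

section Hadamard

open Metric Set
open scoped unitInterval

/-- The primitive of a decreasing function is concave, hence lies below its tangent lines, on both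
sides of `a`. -/
theorem Antitone.integral_sub_integral_le {m : ℝ → ℝ} (hm : Antitone m) (a b : ℝ) :
    (∫ t in (0 : ℝ)..b, m t) - ∫ t in (0 : ℝ)..a, m t ≤ m a * (b - a) := by
  rw [intervalIntegral.integral_interval_sub_left hm.intervalIntegrable hm.intervalIntegrable]
  rcases le_total a b with hab | hba
  · have := intervalIntegral.integral_mono_on hab hm.intervalIntegrable
      (intervalIntegrable_const (μ := volume) (c := m a)) fun x hx => hm hx.1
    simpa [mul_comm] using this
  · rw [intervalIntegral.integral_symm]
    have := intervalIntegral.integral_mono_on hba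
      (intervalIntegrable_const (μ := volume) (c := m a))
      hm.intervalIntegrable fun x hx => hm hx.2
    simp only [intervalIntegral.integral_const, smul_eq_mul] at this
    linarith

/-- A lift of a segment through a map expanding by `m(|x - x₀|)` near `x` stays in the region
where the integral of `m` is bounded by the length of the segment. -/
theorem integral_norm_sub_le_of_lift {E F : Type*} [NormedAddCommGroup E] [NormedAddCommGroup F]
    [NormedSpace ℝ F] {f : E → F} {x₀ : E} {m : ℝ → ℝ} (hm : Antitone m) (hpos : ∀ t, 0 < m t)
    (hexp : ∀ x, ∀ δ < m ‖x - x₀‖, ∀ᶠ z in 𝓝 x, δ * ‖z - x‖ ≤ ‖f z - f x‖)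
    {γ : ℝ → E} {T : ℝ} {p u : F} (hγ : ContinuousOn γ (Icc 0 T)) (h0 : γ 0 = x₀)
    (hlift : ∀ t ∈ Icc 0 T, f (γ t) = p + t • u) {t : ℝ} (ht : t ∈ Icc 0 T) :
    ∫ s in (0 : ℝ)..‖γ t - x₀‖, m s ≤ ‖u‖ * t := by
  set M : ℝ → ℝ := fun r => ∫ s in (0 : ℝ)..r, m s with hM
  have hMc : Continuous M :=
    intervalIntegral.continuous_primitive (fun a b => hm.intervalIntegrable) 0
  have hφc : ContinuousOn (fun t => M ‖γ t - x₀‖) (Icc 0 T) :=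
    hMc.comp_continuousOn (by fun_prop)
  suffices h : ∀ ε > 0, M ‖γ t - x₀‖ ≤ (‖u‖ + ε) * t by
    refine le_of_forall_pos_le_add fun ε hε => ?_
    have ht1 : 0 < t + 1 := by linarith [ht.1]
    have := h (ε / (t + 1)) (by positivity)
    have h2 : ε / (t + 1) * t ≤ ε := by
      rw [div_mul_eq_mul_div, div_le_iff₀ ht1]
      nlinarith
    calc _ ≤ _ := this
      _ = ‖u‖ * t + ε / (t + 1) * t := by ring
      _ ≤ _ := by gcongr
  intro ε hε
  refine image_le_of_liminf_slope_right_lt_deriv_boundary (f := fun t => M ‖γ t - x₀‖)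
    (f' := fun _ => ‖u‖) (B := fun t => (‖u‖ + ε) * t) (B' := fun _ => ‖u‖ + ε) hφc ?_ ?_ ?_ ?_ ht
  · intro a ha r hr
    have hr0 : 0 < r := (norm_nonneg u).trans_lt hr
    set ρ := ‖γ a - x₀‖
    have hmρ : 0 < m ρ := hpos ρ
    -- Expansion is available only for factors below `m ρ`; this `q < 1` puts `q * r` midway between
    -- `‖u‖` and `r`.
    set q : ℝ := (‖u‖ + r) / (2 * r) with hq
    have hq0 : 0 < q := by positivity
    have hq1 : q < 1 := by rw [hq, div_lt_one (by positivity)]; linarith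
    have hqr : ‖u‖ < q * r := by
      have : q * r = (‖u‖ + r) / 2 := by rw [hq]; field_simp
      linarith
    have hle : 𝓝[>] a ≤ 𝓝[Icc 0 T] a := by
      rw [← nhdsWithin_Ioc_eq_nhdsGT ha.2]
      exact nhdsWithin_mono _ fun z hz => ⟨ha.1.trans hz.1.le, hz.2⟩
    have hγa : Tendsto γ (𝓝[>] a) (𝓝 (γ a)) :=
      (hγ a ⟨ha.1, ha.2.le⟩).mono_left hle
    have hmem : ∀ᶠ z in 𝓝[>] a, z ∈ Icc 0 T := hle self_mem_nhdsWithin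
    refine Eventually.frequently ?_
    filter_upwards [hγa.eventually (hexp (γ a) (q * m ρ) (by nlinarith)), hmem,
      self_mem_nhdsWithin] with z hz hzT (hza : a < z)
    rw [hlift z hzT, hlift a ⟨ha.1, ha.2.le⟩, add_sub_add_left_eq_sub, ← sub_smul, norm_smul,
      Real.norm_of_nonneg (sub_nonneg.2 hza.le)] at hz
    have h1 : M ‖γ z - x₀‖ - M ρ ≤ m ρ * ‖γ z - γ a‖ := by
      refine (hm.integral_sub_integral_le _ _).trans ?_
      gcongr
      simpa using norm_sub_norm_le (γ z - x₀) (γ a - x₀)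
    have hza' : 0 < z - a := sub_pos.2 hza
    rw [slope_def_field, div_lt_iff₀ hza']
    refine h1.trans_lt ?_
    refine lt_of_mul_lt_mul_left ?_ hq0.le
    have h2 : (z - a) * ‖u‖ < (z - a) * (q * r) := by gcongr
    linarith
  · simp [h0, hM]
  · intro s
    simpa using (hasDerivAt_id s).const_mul (‖u‖ + ε)
  · intro s _ _
    linarith

/-- If lifts stopped short of time `1`, their endpoints would stay in a compact ball and accumulate
at some `z`; a local inverse at `z` prolongs one of them past the supremum. Only endpoints are
compared, so uniqueness of lifts is not needed. -/
theorem exists_lift_segment {E F : Type*} [NormedAddCommGroup E] [ProperSpace E]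
    [NormedAddCommGroup F] [NormedSpace ℝ F] {f : E → F} (hf : IsLocalHomeomorph f)
    {x₀ : E} {m : ℝ → ℝ} (hm : Antitone m) (hpos : ∀ t, 0 < m t)
    (hint : ∀ B, ∃ R, 0 ≤ R ∧ B < ∫ t in (0 : ℝ)..R, m t)
    (hexp : ∀ x, ∀ δ < m ‖x - x₀‖, ∀ᶠ z in 𝓝 x, δ * ‖z - x‖ ≤ ‖f z - f x‖) (u : F) :
    ∃ γ : ℝ → E, ContinuousOn γ (Icc 0 1) ∧ γ 0 = x₀ ∧
      ∀ t ∈ Icc (0 : ℝ) 1, f (γ t) = f x₀ + t • u := by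
  set S : Set ℝ := {T | 0 ≤ T ∧ ∃ γ : ℝ → E, ContinuousOn γ (Icc 0 T) ∧ γ 0 = x₀ ∧
    ∀ t ∈ Icc 0 T, f (γ t) = f x₀ + t • u} with hS
  suffices h1 : ∃ T ∈ S, 1 ≤ T by
    obtain ⟨T, ⟨-, γ, hγ, h0, hlift⟩, hT⟩ := h1
    have hsub : Icc (0 : ℝ) 1 ⊆ Icc 0 T := Icc_subset_Icc_right hT
    exact ⟨γ, hγ.mono hsub, h0, fun t ht => hlift t (hsub ht)⟩
  by_contra! hlt
  have hbdd : BddAbove S := ⟨1, fun T hT => (hlt T hT).le⟩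
  have hne : S.Nonempty := ⟨0, le_rfl, fun _ => x₀, continuousOn_const, rfl, by simp⟩
  set T := sSup S with hT
  obtain ⟨τ, hτS, hτ⟩ := mem_closure_iff_seq_limit.1 (csSup_mem_closure hne hbdd)
  choose hτ0 γ hγ hγ0 hlift using hτS
  obtain ⟨R, -, hR⟩ := hint (‖u‖ * T)
  have hball : ∀ k, γ k (τ k) ∈ closedBall x₀ R := by
    intro k
    have hk : τ k ∈ Icc 0 (τ k) := ⟨hτ0 k, le_rfl⟩
    have h1 := integral_norm_sub_le_of_lift hm hpos hexp (hγ k) (hγ0 k) (hlift k) hk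
    have h2 : ‖u‖ * τ k ≤ ‖u‖ * T := by
      gcongr
      exact le_csSup hbdd ⟨hτ0 k, γ k, hγ k, hγ0 k, hlift k⟩
    rw [mem_closedBall_iff_norm]
    by_contra! hgt
    have h3 := hm.integral_sub_integral_le ‖γ k (τ k) - x₀‖ R
    have h4 := hpos ‖γ k (τ k) - x₀‖
    nlinarith
  obtain ⟨z, -, φ, hφ, hz⟩ := (isCompact_closedBall x₀ R).tendsto_subseq hball
  have hτφ := hτ.comp hφ.tendsto_atTop
  set q : ℝ → F := fun t => f x₀ + t • u with hq
  have hqc : Continuous q := by fun_prop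
  have hfz : f z = q T := by
    refine tendsto_nhds_unique ((hf.continuous.tendsto z).comp hz)
      (((hqc.tendsto T).comp hτφ).congr fun k => ?_)
    exact (hlift (φ k) _ ⟨hτ0 _, le_rfl⟩).symm
  obtain ⟨e, hze, rfl⟩ := hf z
  have htarget : q ⁻¹' e.target ∈ 𝓝 T := by
    refine hqc.continuousAt.preimage_mem_nhds (e.open_target.mem_nhds ?_)
    rw [← hfz]
    exact e.map_source hze
  obtain ⟨η, hη, hηsub⟩ := Metric.nhds_basis_closedBall.mem_iff.1 htarget
  obtain ⟨k, hk1, hk2⟩ := ((hz.eventually (e.open_source.mem_nhds hze)).and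
    (hτφ.eventually (closedBall_mem_nhds T hη))).exists
  set t₀ := τ (φ k) with ht₀
  set g := γ (φ k) with hg
  replace hk1 : g t₀ ∈ e.source := hk1
  replace hk2 : t₀ ∈ closedBall T η := hk2
  rw [Real.closedBall_eq_Icc] at hk2 hηsub
  have ht₀0 : 0 ≤ t₀ := hτ0 _
  have hg0 : g 0 = x₀ := hγ0 _
  have hglift : ∀ t ∈ Icc 0 t₀, e (g t) = q t := hlift _
  have hgc : ContinuousOn g (Icc 0 t₀) := hγ _
  have hsub : Icc t₀ (T + η) ⊆ q ⁻¹' e.target :=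
    (Icc_subset_Icc_left hk2.1).trans hηsub
  have hmem : T + η ∈ S := by
    refine ⟨ht₀0.trans hk2.2, fun t => if t ≤ t₀ then g t else e.symm (q t), ?_, ?_, ?_⟩
    · rw [← Icc_union_Icc_eq_Icc ht₀0 hk2.2]
      refine ContinuousOn.union_of_isClosed ?_ ?_ isClosed_Icc isClosed_Icc
      · exact hgc.congr fun t ht => if_pos ht.2
      · have : ContinuousOn (fun t => e.symm (q t)) (Icc t₀ (T + η)) :=
          e.continuousOn_symm.comp hqc.continuousOn hsub
        refine this.congr fun t ht => ?_
        rcases ht.1.eq_or_lt with rfl | hlt'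
        · simp only [le_refl, if_true]
          rw [← hglift t₀ ⟨ht₀0, le_rfl⟩, e.left_inv hk1]
        · exact if_neg hlt'.not_ge
    · simp [ht₀0, hg0]
    · intro t ht
      by_cases htt : t ≤ t₀
      · simpa [htt] using hglift t ⟨ht.1, htt⟩
      · simp only [htt, if_false]
        exact e.right_inv (hsub ⟨(not_le.1 htt).le, ht.2⟩)
  have := le_csSup hbdd hmem
  linarith

/-- Hadamard's theorem with an integral condition: a local homeomorphism that expands distances
near each `x` by a factor `m(|x - x₀|)`, where `m` is decreasing with divergent integral, is a
homeomorphism. -/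
theorem IsLocalHomeomorph.isHomeomorph_of_expanding {E F : Type*} [NormedAddCommGroup E]
    [NormedSpace ℝ E] [ProperSpace E] [NormedAddCommGroup F] [NormedSpace ℝ F] {f : E → F}
    (hf : IsLocalHomeomorph f) {x₀ : E} {m : ℝ → ℝ} (hm : Antitone m) (hpos : ∀ t, 0 < m t)
    (hint : ∀ B, ∃ R, 0 ≤ R ∧ B < ∫ t in (0 : ℝ)..R, m t)
    (hexp : ∀ x, ∀ δ < m ‖x - x₀‖, ∀ᶠ z in 𝓝 x, δ * ‖z - x‖ ≤ ‖f z - f x‖) :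
    IsHomeomorph f := by
  choose γ hγ hγ0 hlift using fun y : F => exists_lift_segment hf hm hpos hint hexp (y - f x₀)
  have hsep : IsSeparatedMap f := T2Space.isSeparatedMap f
  let H : C(I × F, F) := ⟨fun ty => f x₀ + (ty.1 : ℝ) • (ty.2 - f x₀), by fun_prop⟩
  have hG : Continuous fun ty : I × F => γ ty.2 ty.1 := by
    refine hf.continuous_lift hsep H (g := fun ty : I × F => γ ty.2 ty.1) ?_ ?_ ?_
    · ext ty
      exact hlift ty.2 ty.1 ty.1.2
    · simpa [hγ0] using continuous_const
    · exact fun y => (hγ y).comp_continuous continuous_subtype_val fun t => t.2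
  have hGc : Continuous fun y => γ y 1 := hG.comp (Continuous.prodMk_right (1 : I))
  have hright : ∀ y, f (γ y 1) = y := fun y => by
    simpa using hlift y 1 (right_mem_Icc.2 zero_le_one)
  -- The lifted segment has length zero, so the integral bound forces distance zero from `x₀`.
  have hx₀ : γ (f x₀) 1 = x₀ := by
    have h1 := integral_norm_sub_le_of_lift hm hpos hexp (hγ (f x₀)) (hγ0 _) (hlift _)
      (right_mem_Icc.2 zero_le_one)
    have h2 := hm.integral_sub_integral_le ‖γ (f x₀) 1 - x₀‖ 0
    have h3 := hpos ‖γ (f x₀) 1 - x₀‖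
    simp only [sub_self, norm_zero, zero_mul, intervalIntegral.integral_same] at h1 h2
    rw [← sub_eq_zero, ← norm_eq_zero]
    nlinarith [norm_nonneg (γ (f x₀) 1 - x₀)]
  -- Both sides lift `f` through `f` and agree at `x₀`; `E` is connected.
  have hleft : (fun x => γ (f x) 1) = id :=
    hsep.eq_of_comp_eq hf.isLocallyInjective (hGc.comp hf.continuous) continuous_id
      (funext fun x => hright (f x)) x₀ hx₀
  exact isHomeomorph_iff_exists_inverse.2
    ⟨hf.continuous, fun y => γ y 1, congrFun hleft, hright, hGc⟩

end Hadamard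

/-! ### From eigenvalues to norm expansion. -/

section Spectral

open Metric Set

/-- A lower bound for the `n`-th powers of the moduli of the eigenvalues of an `n × n` matrix bounds
its determinant from below. -/
theorem Matrix.le_norm_det_of_forall_hasEigenvalue {n : ℕ} (hn : n ≠ 0)
    (A : Matrix (Fin n) (Fin n) ℂ) {σ : ℝ} (hσ : 0 ≤ σ)
    (h : ∀ z, Module.End.HasEigenvalue (Matrix.toLin' A) z → σ ≤ ‖z‖ ^ n) : σ ≤ ‖A.det‖ := by
  -- The characteristic polynomial has `n` roots, so both exponents become `n` and cancel.
  have hprod : ∀ s : Multiset ℂ, (∀ z ∈ s, σ ≤ ‖z‖ ^ n) →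
      σ ^ Multiset.card s ≤ ‖s.prod‖ ^ n := by
    intro s
    induction s using Multiset.induction_on with
    | empty => simp
    | cons a s ih =>
      intro hs
      rw [Multiset.card_cons, Multiset.prod_cons, norm_mul, mul_pow, pow_succ, mul_comm]
      exact mul_le_mul (hs a (by simp)) (ih fun z hz => hs z (by simp [hz])) (by positivity)
        (by positivity)
  have hroots := hprod A.charpoly.roots fun z hz => by
    refine h z ?_
    rw [Module.End.hasEigenvalue_iff_isRoot_charpoly, Matrix.charpoly_toLin']
    exact Polynomial.isRoot_of_mem_roots hz
  rw [← Matrix.det_eq_prod_roots_charpoly, IsAlgClosed.card_roots_eq_natDegree,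
    Matrix.charpoly_natDegree_eq_dim, Fintype.card_fin] at hroots
  exact (pow_le_pow_iff_left₀ hσ (norm_nonneg _) hn).1 hroots

/-- On bounded sets of endomorphisms of `ℝⁿ`, the norm of `A v` is bounded below in terms of the
determinant of `A`. -/
theorem exists_abs_det_mul_norm_le (n : ℕ) (K : ℝ) :
    ∃ C > 0, ∀ A : EuclideanSpace ℝ (Fin n) →L[ℝ] EuclideanSpace ℝ (Fin n), ‖A‖ ≤ K →
      ∀ v, |(standardMatrix A).det| * ‖v‖ ≤ C * ‖A v‖ := by
  set b := (EuclideanSpace.basisFun (Fin n) ℝ).toBasis with hb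
  let L : Matrix (Fin n) (Fin n) ℝ →ₗ[ℝ]
      (EuclideanSpace ℝ (Fin n) →L[ℝ] EuclideanSpace ℝ (Fin n)) :=
    (LinearMap.toContinuousLinearMap.toLinearMap).comp (Matrix.toLin b b).toLinearMap
  let N : (EuclideanSpace ℝ (Fin n) →L[ℝ] EuclideanSpace ℝ (Fin n)) →ₗ[ℝ]
      Matrix (Fin n) (Fin n) ℝ :=
    (LinearMap.toMatrix b b).toLinearMap.comp LinearMap.toContinuousLinearMap.symm.toLinearMap
  have hL : Continuous L := L.continuous_of_finiteDimensional
  have hN : Continuous N := N.continuous_of_finiteDimensional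
  have hNA : ∀ A, N A = standardMatrix A := fun A => rfl
  have : ProperSpace (EuclideanSpace ℝ (Fin n) →L[ℝ] EuclideanSpace ℝ (Fin n)) :=
    FiniteDimensional.proper ℝ _
  -- The adjugate is continuous, hence bounded on the ball, and `adj(A) A = det(A) I`.
  obtain ⟨C, hC⟩ := ((isCompact_closedBall (0 : EuclideanSpace ℝ (Fin n) →L[ℝ] _) K).image
    (hL.comp hN.matrix_adjugate)).isBounded.exists_norm_le
  refine ⟨max C 1, by positivity, fun A hA v => ?_⟩
  have hnorm : ‖L (N A).adjugate‖ ≤ max C 1 :=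
    (hC _ ⟨A, by simpa using hA, rfl⟩).trans (le_max_left _ _)
  have hid : L (N A).adjugate (A v) = (N A).det • v := by
    have h1 : Matrix.toLin b b ((N A).adjugate * N A) v = (N A).det • v := by
      rw [Matrix.adjugate_mul, map_smul, Matrix.toLin_one]
      rfl
    rw [← h1, Matrix.toLin_mul b b b]
    change _ = Matrix.toLin b b (N A).adjugate (Matrix.toLin b b (LinearMap.toMatrix b b A.toLinearMap) v)
    rw [Matrix.toLin_toMatrix]
    rfl
  calc |(standardMatrix A).det| * ‖v‖ = ‖L (N A).adjugate (A v)‖ := by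
        rw [hid, norm_smul, hNA, Real.norm_eq_abs]
    _ ≤ ‖L (N A).adjugate‖ * ‖A v‖ := ContinuousLinearMap.le_opNorm _ _
    _ ≤ _ := by gcongr

theorem spectralInf_antitone {n : ℕ}
    (f : EuclideanSpace ℝ (Fin n) → EuclideanSpace ℝ (Fin n)) (x₀ : EuclideanSpace ℝ (Fin n)) :
    Antitone (spectralInf f x₀) := fun _ _ hst =>
  biInf_mono fun _ hx => closedBall_subset_closedBall hst hx

theorem spectralInf_toReal_le_abs_det {n : ℕ} (hn : n ≠ 0)
    {f : EuclideanSpace ℝ (Fin n) → EuclideanSpace ℝ (Fin n)} {x₀ x : EuclideanSpace ℝ (Fin n)}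
    {t : ℝ} (hx : x ∈ closedBall x₀ t)
    {A : EuclideanSpace ℝ (Fin n) →L[ℝ] EuclideanSpace ℝ (Fin n)}
    (hA : A ∈ clarkeDifferential f x) :
    (spectralInf f x₀ t).toReal ≤ |(standardMatrix A).det| := by
  have hdet : ((standardMatrix A).map (algebraMap ℝ ℂ)).det
      = ((standardMatrix A).det : ℂ) := (RingHom.map_det (algebraMap ℝ ℂ) _).symm
  have := Matrix.le_norm_det_of_forall_hasEigenvalue hn ((standardMatrix A).map (algebraMap ℝ ℂ))
    (σ := (spectralInf f x₀ t).toReal) ENNReal.toReal_nonneg fun z hz => by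
      refine ENNReal.toReal_le_of_le_ofReal (by positivity) ?_
      exact iInf₂_le_of_le x hx (iInf₂_le z ⟨A, hA, hz⟩)
  rwa [hdet, Complex.norm_real, Real.norm_eq_abs] at this

/-- A complex matrix of positive size has an eigenvalue. Finiteness keeps `toReal` from turning `∞`
into `0`. -/
theorem spectralInf_ne_top {n : ℕ} (hn : n ≠ 0)
    {f : EuclideanSpace ℝ (Fin n) → EuclideanSpace ℝ (Fin n)} {x₀ : EuclideanSpace ℝ (Fin n)}
    (hne : (clarkeDifferential f x₀).Nonempty) {t : ℝ} (ht : 0 ≤ t) :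
    spectralInf f x₀ t ≠ ∞ := by
  obtain ⟨A, hA⟩ := hne
  have : NeZero n := ⟨hn⟩
  obtain ⟨z, hz⟩ := Module.End.exists_eigenvalue
    (Matrix.toLin' ((standardMatrix A).map (algebraMap ℝ ℂ)))
  refine ne_top_of_le_ne_top ENNReal.ofReal_ne_top (b := ENNReal.ofReal (‖z‖ ^ n)) ?_
  exact iInf₂_le_of_le x₀ (mem_closedBall_self ht) (iInf₂_le z ⟨A, hA, hz⟩)

end Spectral

/-! ### Decreasing functions with divergent integral. -/

section IntegralDivergence

open Set

theorem Antitone.exists_lt_integral_of_lintegral_eq_top {m : ℝ → ℝ} (hm : Antitone m)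
    (h0 : ∀ t, 0 ≤ m t) (h : ∫⁻ t in Ioi (0 : ℝ), ENNReal.ofReal (m t) = ∞) (B : ℝ) :
    ∃ R, 0 ≤ R ∧ B < ∫ t in (0 : ℝ)..R, m t := by
  by_contra! hB
  have hint : IntegrableOn m (Ioi 0) := by
    refine integrableOn_Ioi_of_intervalIntegral_norm_bounded (l := atTop) (b := fun k : ℕ => (k : ℝ))
      B 0 (fun k => ?_) tendsto_natCast_atTop_atTop (Eventually.of_forall fun k => ?_)
    · exact (hm.intervalIntegrable (a := 0) (b := (k : ℝ))).1
    · simpa only [Real.norm_of_nonneg (h0 _)] using hB k k.cast_nonneg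
  exact hint.lintegral_lt_top.ne h

/-- At a zero of `m` the tangent line is horizontal and bounds the primitive. -/
theorem Antitone.pos_of_forall_exists_lt_integral {m : ℝ → ℝ} (hm : Antitone m)
    (h0 : ∀ t, 0 ≤ m t) (h : ∀ B, ∃ R, 0 ≤ R ∧ B < ∫ t in (0 : ℝ)..R, m t) (t : ℝ) : 0 < m t := by
  refine (h0 t).lt_of_ne fun ht => ?_
  obtain ⟨R, -, hR⟩ := h (∫ s in (0 : ℝ)..t, m s)
  have := hm.integral_sub_integral_le t R
  rw [← ht, zero_mul] at this
  linarith

end IntegralDivergence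

/-! ### The global theorem. -/

theorem mainTheorem3 (n : ℕ) (f : EuclideanSpace ℝ (Fin n) → EuclideanSpace ℝ (Fin n))
    (hf : ∃ K : NNReal, LipschitzWith K f)
    (hrank : ∀ x : EuclideanSpace ℝ (Fin n), ClarkeMaximalRank f x)
    (x₀ : EuclideanSpace ℝ (Fin n))
    (hs : ∫⁻ t in Set.Ioi (0 : ℝ), spectralInf f x₀ t = ∞) :
    IsHomeomorph f := by
  obtain ⟨K, hK⟩ := hf
  rcases eq_or_ne n 0 with rfl | hn
  · exact ⟨hK.continuous, fun U _ => isOpen_discrete _,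
      Function.injective_of_subsingleton f, Function.surjective_to_subsingleton f⟩
  have hne := hK.nonempty_clarkeDifferential x₀
  have hfin : ∀ t : ℝ, spectralInf f x₀ (max t 0) ≠ ∞ := fun t =>
    spectralInf_ne_top hn hne (le_max_right _ _)
  -- For `t < 0` the ball is empty and the infimum `∞` would become `0` under `toReal`, spoiling
  -- monotonicity; hence `max t 0`.
  set σ : ℝ → ℝ := fun t => (spectralInf f x₀ (max t 0)).toReal with hσ
  have hσanti : Antitone σ := fun s t hst => ENNReal.toReal_mono (hfin s)
    (spectralInf_antitone f x₀ (max_le_max_right 0 hst))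
  have hσ0 : ∀ t, 0 ≤ σ t := fun t => ENNReal.toReal_nonneg
  have hσint : ∀ B, ∃ R, 0 ≤ R ∧ B < ∫ t in (0 : ℝ)..R, σ t := by
    refine hσanti.exists_lt_integral_of_lintegral_eq_top hσ0 (Eq.trans ?_ hs)
    refine setLIntegral_congr_fun measurableSet_Ioi fun t (ht : 0 < t) => ?_
    simp only [hσ]
    rw [ENNReal.ofReal_toReal (hfin t), max_eq_left ht.le]
  have hσpos := hσanti.pos_of_forall_exists_lt_integral hσ0 hσint
  obtain ⟨C, hC, hdet⟩ := exists_abs_det_mul_norm_le n K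
  have hlower : ∀ x, ∀ A ∈ clarkeDifferential f x, ∀ v, σ ‖x - x₀‖ / C * ‖v‖ ≤ ‖A v‖ := by
    intro x A hA v
    rw [div_mul_eq_mul_div, div_le_iff₀' hC]
    refine le_trans ?_ (hdet A (hK.norm_le_of_mem_clarkeDifferential hA) v)
    gcongr
    refine spectralInf_toReal_le_abs_det hn ?_ hA
    rw [mem_closedBall_iff_norm]
    exact le_max_left _ _
  have hloc : IsLocalHomeomorph f := hK.isLocalHomeomorph_of_clarkeDifferential fun x =>
    ⟨_, div_pos (hσpos _) hC, hlower x⟩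
  refine hloc.isHomeomorph_of_expanding (x₀ := x₀) (m := fun t => σ t / C)
    (fun s t hst => div_le_div_of_nonneg_right (hσanti hst) hC.le)
    (fun t => div_pos (hσpos t) hC) (fun B => ?_) fun x δ hδ => ?_
  · obtain ⟨R, hR, hBR⟩ := hσint (B * C)
    refine ⟨R, hR, ?_⟩
    rwa [intervalIntegral.integral_div, lt_div_iff₀ hC]
  · obtain ⟨r, hr, hexp⟩ := hK.exists_mul_norm_sub_le_of_clarkeDifferential (hlower x) hδ
    filter_upwards [Metric.ball_mem_nhds x hr] with z hz
    exact hexp x (Metric.mem_ball_self hr) z hz
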